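/- Let $G$ be an infinite countable discrete group acting by homeomorphisms on a compact metrizable space $M$ as a convergence group: for every sequence $(g_n)$ of pairwise distinct elements of $G$ there are a subsequence $(g_{n_k})$ and points $a,b\in M$ such that for every compact $K\subset M\setminus\{a\}$ and every open $U\ni b$ one has $g_{n_k}(K)\subset U$ for all large $k$. Assume that the action is non-elementary (there is no invariant subset of $M$ with exactly one or two points) and minimal (every orbit is dense). Let $\mu$ be a probability measure on $G$ whose support generates $G$. Let $T$ be the set of ordered triples of pairwise distinct points of $M$. For $x\in T$, give $G\cup M$ (disjoint union) the topology generated by all subsets of $G$ and all sets $$\widetilde U_G=\{g\in G : gx \text{ has at least two components in } U\}\cup U,\qquad U\subset M\text{ open}.$$ For a Borel measure $\nu$ on $M$ put $(g\nu)(A)=\nu(g^{-1}A)$; $\nu$ is $\mu$-stationary if $\nu(A)=\sum_{g\in G}\mu(g)\,(g\nu)(A)$ for all Borel $A\subset M$. A function $h:G\to\mathbb R$ is $\mu$-harmonic if $h(g)=\sum_{k\in G}\mu(k)h(gk)$ for all $g\in G$. Then: 1. For every $x\in T$ the Dirichlet problem at infinity on $G\cup M$ is solvable: every continuous $f:M\to\mathbb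 R$ has a continuous extension $h:G\cup M\to\mathbb R$ that is $\mu$-harmonic on $G$. 2. There is exactly one $\mu$-stationary Borel probability measure $\nu$ on $M$, and for every $x\in T$ the following hold. For every $g\in G$, almost every path $(g\,g_1\cdots g_n)_n$ of the random walk started at $g$, with independent $\mu$-distributed steps $g_1,g_2,\dots$, converges in $G\cup M$ to a point of $M$, and the law of the limit is $g\nu$. For every continuous $f:M\to\mathbb R$, the continuous extension of $f$ to $G\cup M$ that is $\mu$-harmonic on $G$ is unique and is given on $G$ by the Poisson formula $$h(g)=\int_M f\,d(g\nu).$$ -/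

import Mathlib

open MeasureTheory Filter Topology

namespace ConvergenceGroup

/-- The action of `G` on `M` has the convergence property: every sequence of pairwise distinct
elements of `G` has a subsequence that converges to some point `b`, locally uniformly on the
complement of some point `a` (with `a = b` allowed). -/
def IsConvergenceAction (G M : Type*) [Group G] [TopologicalSpace M] [MulAction G M] : Prop :=
  ∀ g : ℕ → G, Function.Injective g →
    ∃ (φ : ℕ → ℕ) (a b : M), StrictMono φ ∧
      ∀ K : Set M, IsCompact K → K ⊆ {a}ᶜ → ∀ U : Set M, IsOpen U → b ∈ U →
        ∃ N : ℕ, ∀ k, N < k → ∀ y ∈ K, g (φ k) • y ∈ U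

/-- The action has no invariant subset consisting of one or two points. -/
def IsNonelementary (G M : Type*) [Group G] [MulAction G M] : Prop :=
  ¬ ∃ s : Set M, s.Nonempty ∧ s.encard ≤ 2 ∧ ∀ g : G, ∀ y ∈ s, g • y ∈ s

/-- The space `T` of ordered triples of pairwise distinct points of `M`. -/
abbrev DistinctTriple (M : Type*) : Type _ := {x : Fin 3 → M // Function.Injective x}

/-- The disjoint union `G ∪ M`. It is a type of its own (rather than `G ⊕ M`) so that it carries
the topology defined below from the base point `x`, and not the topology of the disjoint sum. -/
inductive GroupUnion (G : Type*) {M : Type*} (x : DistinctTriple M) : Type _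
  | ofGroup (g : G) : GroupUnion G x
  | ofBoundary (p : M) : GroupUnion G x

namespace GroupUnion

variable {G M : Type*} [Group G] [MulAction G M]

/-- For `U ⊆ M`, the set of all `g ∈ G` such that `g x` has at least two components in `U`,
together with all the points of `U`. -/
def extend (x : DistinctTriple M) (U : Set M) : Set (GroupUnion G x) :=
  {z | match z with
    | ofGroup g => ∃ i j : Fin 3, i ≠ j ∧ g • x.1 i ∈ U ∧ g • x.1 j ∈ U
    | ofBoundary p => p ∈ U}

/-- The topology on `G ∪ M` generated by all subsets of `G` and by the sets `extend x U` with
`U` open in `M`. -/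
instance instTopologicalSpace [TopologicalSpace M] (x : DistinctTriple M) :
    TopologicalSpace (GroupUnion G x) :=
  TopologicalSpace.generateFrom
    ({S | ∃ A : Set G, S = ofGroup '' A} ∪ {S | ∃ U : Set M, IsOpen U ∧ S = extend x U})

end GroupUnion

/-- A function on `G` is `μ`-harmonic if `f g = ∑ₖ μ(k) f(g k)` for every `g`. -/
def IsHarmonic {G : Type*} [Group G] [MeasurableSpace G] (μ : Measure G) (f : G → ℝ) : Prop :=
  ∀ g : G, HasSum (fun k : G => μ.real {k} * f (g * k)) (f g)

/-- `h` solves the Dirichlet problem at infinity with boundary values `f`: it is continuous on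
`G ∪ M`, it is `μ`-harmonic on `G`, and it restricts to `f` on `M`. -/
structure IsDirichletSolution {G M : Type*} [Group G] [MeasurableSpace G] [TopologicalSpace M]
    [MulAction G M] (μ : Measure G) (x : DistinctTriple M) (f : C(M, ℝ))
    (h : GroupUnion G x → ℝ) : Prop where
  continuous : Continuous h
  harmonic : IsHarmonic μ (fun g : G => h (.ofGroup g))
  boundary : ∀ p : M, h (.ofBoundary p) = f p

/-- The Dirichlet problem at infinity on `G ∪ M` is solvable: every continuous function on `M`
has a continuous extension to `G ∪ M` that is `μ`-harmonic on `G`. -/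
def DirichletProblemSolvable {G M : Type*} [Group G] [MeasurableSpace G] [TopologicalSpace M]
    [MulAction G M] (μ : Measure G) (x : DistinctTriple M) : Prop :=
  ∀ f : C(M, ℝ), ∃ h : GroupUnion G x → ℝ, IsDirichletSolution μ x f h

/-- The translate `gν` of a measure, `(gν)(A) = ν(g⁻¹ A)`. -/
noncomputable def translate {G M : Type*} [Group G] [MulAction G M] [MeasurableSpace M]
    (g : G) (ν : Measure M) : Measure M :=
  ν.map (fun p => g • p)

/-- `ν` is `μ`-stationary: `ν(A) = ∑_g μ(g) (gν)(A)` for every measurable `A`. -/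
def IsStationary {G M : Type*} [Group G] [MulAction G M] [MeasurableSpace G] [MeasurableSpace M]
    (μ : Measure G) (ν : Measure M) : Prop :=
  ∀ A : Set M, MeasurableSet A → ν A = ∑' g : G, μ {g} * translate g ν A

/-- The Poisson extension of `f` to `G ∪ M`: it is `f` on `M` and `g ↦ ∫ f d(gν)` on `G`. -/
noncomputable def poissonExtension {G M : Type*} [Group G] [MulAction G M] [TopologicalSpace M]
    [MeasurableSpace M] (ν : Measure M) (x : DistinctTriple M) (f : C(M, ℝ)) :
    GroupUnion G x → ℝ
  | .ofGroup g => ∫ p, f p ∂(translate g ν)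
  | .ofBoundary p => f p

/-- The position at time `n` of the random walk that starts at `g₀` and has the steps
`ω 0, ω 1, …`, that is, the product `g₀ * ω 0 * ⋯ * ω (n - 1)`. -/
def walk {G : Type*} [Group G] (g₀ : G) (ω : ℕ → G) : ℕ → G
  | 0 => g₀
  | n + 1 => walk g₀ ω n * ω n

/-- `κ` is the hitting measure on `M` of the random walk `(G, μ)` that starts at `g₀`: almost every
sample path, with independent `μ`-distributed steps, converges in `G ∪ M` to a point of `M`, and
this limit point has the law `κ`. -/
def IsHittingMeasure {G M : Type*} [Group G] [MeasurableSpace G] [TopologicalSpace M]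
    [MeasurableSpace M] [MulAction G M] (μ : Measure G) [IsProbabilityMeasure μ]
    (x : DistinctTriple M) (g₀ : G) (κ : Measure M) : Prop :=
  ∃ Z : (ℕ → G) → M, Measurable Z ∧
    (∀ᵐ ω ∂(Measure.infinitePi fun _ : ℕ => μ),
      Tendsto (fun n => (GroupUnion.ofGroup (walk g₀ ω n) : GroupUnion G x)) atTop
        (𝓝 (GroupUnion.ofBoundary (Z ω)))) ∧
    (Measure.infinitePi fun _ : ℕ => μ).map Z = κ

end ConvergenceGroup

/-!
The key observation concerns a stationary measure `ν`. It has no atoms: its atoms of maximal mass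
form a finite set that is invariant under the support of `μ`, hence under `G`, and a non-elementary
convergence action has no finite invariant set (`IsConvergenceAction.not_invariant_finite`,
`IsStationary.measure_singleton`). If now `u n • y` tends to `b` for all `y` but one, then `u n`
tends to `b` in `G ∪ M`, and `∫ f d(u n ν)` tends to `f b` by dominated convergence. By the
convergence property every sequence that leaves the finite subsets of `G` has a subsequence of this
kind. Therefore the Poisson extension `g ↦ ∫ f d(gν)` of `f` is continuous on `G ∪ M`, and it is
harmonic by stationarity (`IsStationary.isDirichletSolution_poissonExtension`). A stationary
measure exists by compactness of the space of probability measures (`exists_isStationary`).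

Along the random walk, the functions `φ g = ∫ f d(gν)` are bounded martingales. Their increments
are square summable, so a state `g` can be visited infinitely often with positive probability only
if each of these `φ` is constant along the steps from `g` (`ae_eventually_walk_ne`). Then `ν` would
be invariant under `G`, hence a point mass by the convergence property, which is impossible
(`exists_poissonIntegral_ne`). So the walk leaves every finite set, and the martingale convergence
theorem, applied to countably many `f` that separate the points of `M`, shows that all its limit
points coincide (`IsStationary.ae_exists_tendsto_walk`).

Finally, any solution `h` of the Dirichlet problem is bounded, and `h` along the walk is a bounded
martingale that converges to the boundary values at the limit point of the walk. Hence `h g` is the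
mean of `f` under the law of the limit point of the walk started at `g`
(`IsDirichletSolution.eq_integral_limit`). This gives the uniqueness of `h`, and, applied to Poisson
extensions, it identifies that law with `gν` and shows that `ν` is unique.
-/

namespace ConvergenceGroup

/-! ### The topology of `G ∪ M` near the boundary -/

section Boundary

variable {G M : Type*} [Group G] [MulAction G M]

namespace GroupUnion

theorem extend_mono (x : DistinctTriple M) {U V : Set M} (h : U ⊆ V) :
    (extend x U : Set (GroupUnion G x)) ⊆ extend x V := by
  rintro (g | p) hz
  · obtain ⟨i, j, hij, hi, hj⟩ := hz
    exact ⟨i, j, hij, h hi, h hj⟩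
  · exact h hz

theorem nhds_ofBoundary_hasBasis [TopologicalSpace M] (x : DistinctTriple M) (b : M) :
    (𝓝 (ofBoundary b : GroupUnion G x)).HasBasis (fun U : Set M => IsOpen U ∧ b ∈ U)
      (extend x) := by
  refine ⟨fun t => ⟨fun ht => ?_, ?_⟩⟩
  · obtain ⟨o, hot, ho, hbo⟩ := mem_nhds_iff.1 ht
    suffices ∃ U : Set M, (IsOpen U ∧ b ∈ U) ∧ extend x U ⊆ o by
      obtain ⟨U, hU, hUo⟩ := this
      exact ⟨U, hU, hUo.trans hot⟩
    have ho' : TopologicalSpace.GenerateOpen _ o := ho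
    clear ho ht hot
    induction ho' with
    | basic s hs =>
      rcases hs with ⟨A, rfl⟩ | ⟨U, hU, rfl⟩
      · obtain ⟨g, -, hg⟩ := hbo
        cases hg
      · exact ⟨U, ⟨hU, hbo⟩, subset_rfl⟩
    | univ => exact ⟨Set.univ, ⟨isOpen_univ, trivial⟩, Set.subset_univ _⟩
    | inter s t _ _ ihs iht =>
      obtain ⟨U, hU, hUs⟩ := ihs hbo.1
      obtain ⟨V, hV, hVt⟩ := iht hbo.2
      exact ⟨U ∩ V, ⟨hU.1.inter hV.1, hU.2, hV.2⟩, Set.subset_inter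
        ((extend_mono x Set.inter_subset_left).trans hUs)
        ((extend_mono x Set.inter_subset_right).trans hVt)⟩
    | sUnion S _ ih =>
      obtain ⟨s, hs, hbs⟩ := hbo
      obtain ⟨U, hU, hUs⟩ := ih s hs hbs
      exact ⟨U, hU, hUs.trans (Set.subset_sUnion_of_mem hs)⟩
  · rintro ⟨U, hU, hUt⟩
    exact mem_of_superset
      (IsOpen.mem_nhds (TopologicalSpace.isOpen_generateFrom_of_mem (Or.inr ⟨U, hU.1, rfl⟩)) hU.2)
      hUt

theorem isOpen_singleton_ofGroup [TopologicalSpace M] (x : DistinctTriple M) (g : G) :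
    IsOpen ({ofGroup g} : Set (GroupUnion G x)) :=
  TopologicalSpace.isOpen_generateFrom_of_mem (Or.inl ⟨{g}, by simp⟩)

/-- The trace on `G` of the filter of neighbourhoods of `b` in `G ∪ M`: a sequence in `G` tends to
`b` in `G ∪ M` if and only if it tends to this filter. -/
def boundaryFilter (G : Type*) [Group G] [MulAction G M] [TopologicalSpace M]
    (x : DistinctTriple M) (b : M) : Filter G :=
  comap (ofGroup : G → GroupUnion G x) (𝓝 (ofBoundary b))

variable [TopologicalSpace M]

theorem boundaryFilter_hasBasis (x : DistinctTriple M) (b : M) :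
    (boundaryFilter G x b).HasBasis (fun U : Set M => IsOpen U ∧ b ∈ U)
      fun U => {g | ∃ i j : Fin 3, i ≠ j ∧ g • x.1 i ∈ U ∧ g • x.1 j ∈ U} :=
  (nhds_ofBoundary_hasBasis x b).comap _

theorem tendsto_boundaryFilter {ι : Type*} {l : Filter ι} {u : ι → G} {x : DistinctTriple M}
    {b : M} : Tendsto u l (boundaryFilter G x b) ↔
      Tendsto (fun n => (ofGroup (u n) : GroupUnion G x)) l (𝓝 (ofBoundary b)) :=
  tendsto_comap_iff

theorem boundaryFilter_le_cofinite [T1Space M] (x : DistinctTriple M) (b : M) :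
    boundaryFilter G x b ≤ cofinite := by
  rw [le_cofinite_iff_eventually_ne]
  intro g
  -- remove from `M` the components of `g x` other than `b`: at most one component is left
  refine (boundaryFilter_hasBasis x b).mem_iff.2
    ⟨((Set.range fun i => g • x.1 i) \ {b})ᶜ,
      ⟨((Set.finite_range _).subset Set.sdiff_subset).isClosed.isOpen_compl, by simp⟩, ?_⟩
  rintro k ⟨i, j, hij, hi, hj⟩ rfl
  simp only [Set.mem_compl_iff, Set.mem_sdiff, Set.mem_range_self, true_and,
    Set.mem_singleton_iff, not_not] at hi hj
  exact hij (x.2 (MulAction.injective k (hi.trans hj.symm)))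

instance [FirstCountableTopology M] (x : DistinctTriple M) (b : M) :
    (boundaryFilter G x b).IsCountablyGenerated := by
  obtain ⟨U, hU, ⟨hbasis, -⟩⟩ := (nhds_basis_opens b).exists_antitone_subbasis
  refine HasCountableBasis.isCountablyGenerated (ι := ℕ) (p := fun _ => True)
    (s := fun n => {g : G | ∃ i j : Fin 3, i ≠ j ∧ g • x.1 i ∈ U n ∧ g • x.1 j ∈ U n})
    ⟨⟨fun t => ?_⟩, Set.to_countable _⟩
  rw [(boundaryFilter_hasBasis x b).mem_iff]
  constructor
  · rintro ⟨V, ⟨hV, hbV⟩, hVt⟩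
    obtain ⟨n, -, hn⟩ := hbasis.mem_iff.1 (hV.mem_nhds hbV)
    refine ⟨n, trivial, fun g hg => hVt ?_⟩
    obtain ⟨i, j, hij, hi, hj⟩ := hg
    exact ⟨i, j, hij, hn hi, hn hj⟩
  · rintro ⟨n, -, hn⟩
    exact ⟨U n, (hU n).symm, hn⟩

/-- If `u n • y` tends to `b` for every `y` except perhaps one, then `u n` tends to `b`: at most
one component of the base triple is exceptional. -/
theorem tendsto_boundaryFilter_of_forall_ne {u : ℕ → G} {a b : M}
    (h : ∀ y, y ≠ a → Tendsto (fun n => u n • y) atTop (𝓝 b)) (x : DistinctTriple M) :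
    Tendsto u atTop (boundaryFilter G x b) := by
  refine (boundaryFilter_hasBasis x b).tendsto_right_iff.2 fun U hU => ?_
  have hab : ∃ i j : Fin 3, i ≠ j ∧ x.1 i ≠ a ∧ x.1 j ≠ a := by
    have h01 : x.1 0 ≠ x.1 1 := x.2.ne (by decide)
    have h02 : x.1 0 ≠ x.1 2 := x.2.ne (by decide)
    have h12 : x.1 1 ≠ x.1 2 := x.2.ne (by decide)
    by_cases h0 : x.1 0 = a
    · exact ⟨1, 2, by decide, fun h => h01 (h0.trans h.symm), fun h => h02 (h0.trans h.symm)⟩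
    · by_cases h1 : x.1 1 = a
      · exact ⟨0, 2, by decide, h0, fun h => h12 (h1.trans h.symm)⟩
      · exact ⟨0, 1, by decide, h0, h1⟩
  obtain ⟨i, j, hij, hi, hj⟩ := hab
  filter_upwards [(h _ hi).eventually (hU.1.mem_nhds hU.2),
    (h _ hj).eventually (hU.1.mem_nhds hU.2)] with n hn hn'
  exact ⟨i, j, hij, hn, hn'⟩

/-- A single-valued choice of a component of `g x` that follows `g` to the boundary: a component
belonging to a closest pair of components. -/
theorem exists_tendsto_of_boundaryFilter [TopologicalSpace.MetrizableSpace M]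
    (x : DistinctTriple M) :
    ∃ c : G → M, ∀ b, Tendsto c (boundaryFilter G x b) (𝓝 b) := by
  let := TopologicalSpace.metrizableSpaceMetric M
  have hmin : ∀ g : G, ∃ p : Fin 3 × Fin 3, p.1 ≠ p.2 ∧ ∀ q : Fin 3 × Fin 3, q.1 ≠ q.2 →
      dist (g • x.1 p.1) (g • x.1 p.2) ≤ dist (g • x.1 q.1) (g • x.1 q.2) := fun g => by
    obtain ⟨p, hp, hle⟩ := (Set.toFinite {p : Fin 3 × Fin 3 | p.1 ≠ p.2}).exists_minimalFor
      (fun p => dist (g • x.1 p.1) (g • x.1 p.2)) _ ⟨(0, 1), by simp⟩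
    exact ⟨p, hp, fun q hq => (le_total _ _).elim id (hle hq)⟩
  choose p hp hple using hmin
  refine ⟨fun g => g • x.1 (p g).1, fun b => Metric.nhds_basis_ball.tendsto_right_iff.2
    fun ε hε => ?_⟩
  refine (boundaryFilter_hasBasis x b).mem_iff.2 ⟨Metric.ball b (ε / 3),
    ⟨Metric.isOpen_ball, Metric.mem_ball_self (by positivity)⟩, ?_⟩
  rintro g ⟨i, j, hij, hi, hj⟩
  rw [Metric.mem_ball] at hi hj
  have hpair : dist (g • x.1 (p g).1) (g • x.1 (p g).2) < ε / 3 + ε / 3 :=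
    ((hple g (i, j) hij).trans (dist_triangle_right _ _ b)).trans_lt (add_lt_add hi hj)
  -- two pairs among three indices have a common member
  have key : (p g).1 = i ∨ (p g).1 = j ∨ (p g).2 = i ∨ (p g).2 = j := by
    have := hp g
    generalize (p g).1 = r at *
    generalize (p g).2 = s at *
    clear hi hj hpair
    omega
  show dist (g • x.1 (p g).1) b < ε
  rcases key with h | h | h | h
  · rw [h]; linarith
  · rw [h]; linarith
  · rw [h] at hpair
    linarith [dist_triangle (g • x.1 (p g).1) (g • x.1 i) b]
  · rw [h] at hpair
    linarith [dist_triangle (g • x.1 (p g).1) (g • x.1 j) b]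

end GroupUnion

/-- The convergence property, in pointwise form, for a sequence that leaves every finite subset of
the group (but may have repetitions). -/
theorem IsConvergenceAction.exists_subseq [TopologicalSpace M] [T1Space M]
    (hconv : IsConvergenceAction G M) {u : ℕ → G} (hu : Tendsto u atTop cofinite) :
    ∃ (φ : ℕ → ℕ) (a b : M), Tendsto φ atTop atTop ∧
      ∀ y, y ≠ a → Tendsto (fun n => u (φ n) • y) atTop (𝓝 b) := by
  obtain ⟨ψ, -, hψ⟩ := exists_seq_of_forall_finset_exists (α := ℕ) (fun _ => True)
    (fun m n => m < n ∧ u m ≠ u n) fun s _ => by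
      have h1 : ∀ᶠ n in atTop, ∀ m ∈ s, m < n :=
        (eventually_all_finset s).2 fun m _ => eventually_gt_atTop m
      have h2 : ∀ᶠ n in atTop, ∀ m ∈ s, u n ≠ u m :=
        (eventually_all_finset s).2 fun m _ => hu.eventually (eventually_cofinite_ne (u m))
      obtain ⟨n, hn1, hn2⟩ := (h1.and h2).exists
      exact ⟨n, trivial, fun m hm => ⟨hn1 m hm, (hn2 m hm).symm⟩⟩
  have hmono : StrictMono ψ := fun m n h => (hψ m n h).1
  have hinj : Function.Injective (u ∘ ψ) := by
    intro m n h
    by_contra hne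
    rcases lt_or_gt_of_ne hne with hlt | hlt
    · exact (hψ m n hlt).2 h
    · exact (hψ n m hlt).2 h.symm
  obtain ⟨φ, a, b, hφ, h⟩ := hconv _ hinj
  refine ⟨ψ ∘ φ, a, b, hmono.tendsto_atTop.comp hφ.tendsto_atTop, fun y hy => ?_⟩
  refine (nhds_basis_opens b).tendsto_right_iff.2 fun U hU => ?_
  obtain ⟨N, hN⟩ := h {y} isCompact_singleton (by simpa using hy.symm) U hU.2 hU.1
  filter_upwards [eventually_gt_atTop N] with k hk
  exact hN k hk y rfl

theorem exists_tendsto_cofinite_of_infinite (G : Type*) [Infinite G] :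
    ∃ u : ℕ → G, Tendsto u atTop cofinite :=
  ⟨Infinite.natEmbedding G, by
    rw [← Nat.cofinite_eq_atTop]; exact (Infinite.natEmbedding G).injective.tendsto_cofinite⟩

end Boundary

/-! ### Stationary measures -/

section Stationary

variable {G M : Type*} [Group G] [MulAction G M]

/-- A finite nonempty set cannot be invariant: with three points or more, two of them would be
moved to distinct points of the set that converge to a common limit. -/
theorem IsConvergenceAction.not_invariant_finite [Infinite G] [TopologicalSpace M] [T1Space M]
    (hconv : IsConvergenceAction G M) (hne : IsNonelementary G M) {F : Set M} (hF : F.Finite)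
    (hF' : F.Nonempty) : ¬ ∀ g : G, ∀ y ∈ F, g • y ∈ F := by
  intro hinv
  by_cases hcard : F.encard ≤ 2
  · exact hne ⟨F, hF', hcard, hinv⟩
  obtain ⟨u, hu⟩ := exists_tendsto_cofinite_of_infinite G
  obtain ⟨φ, a, b, -, h⟩ := hconv.exists_subseq hu
  have h1 : 1 < (F \ {a}).encard := by
    by_contra! hle
    have h2 : F.encard ≤ (F \ {a}).encard + 1 := by
      have := Set.encard_le_encard_sdiff_add_encard F {a}
      rwa [Set.encard_singleton] at this
    exact hcard (h2.trans (by calc _ ≤ (1 : ℕ∞) + 1 := by gcongr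
                                _ = 2 := by norm_num))
  obtain ⟨p, q, hp, hq, hpq⟩ := Set.one_lt_encard_iff.1 h1
  have hev : ∀ y ∈ F \ {a}, ∀ᶠ n in atTop, u (φ n) • y = b := fun y hy => by
    have hU : (F \ {b})ᶜ ∈ 𝓝 b := (hF.subset Set.sdiff_subset).isClosed.isOpen_compl.mem_nhds
      (by simp)
    filter_upwards [(h y hy.2).eventually hU] with n hn
    by_contra hb
    exact hn ⟨hinv _ _ hy.1, hb⟩
  obtain ⟨n, hn, hn'⟩ := ((hev p hp).and (hev q hq)).exists
  exact hpq (MulAction.injective (u (φ n)) (hn.trans hn'.symm))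

variable [Countable G] [MeasurableSpace G] [DiscreteMeasurableSpace G]
  [TopologicalSpace M] [MeasurableSpace M] [BorelSpace M] [ContinuousConstSMul G M]

theorem measurable_smul_prod : Measurable fun p : G × M => p.1 • p.2 :=
  measurable_from_prod_countable_right fun g => (continuous_const_smul g).measurable

omit [Countable G] [MeasurableSpace G] [DiscreteMeasurableSpace G] in
theorem translate_apply (g : G) (ν : Measure M) {A : Set M} (hA : MeasurableSet A) :
    translate g ν A = ν ((fun p => g • p) ⁻¹' A) :=
  Measure.map_apply (continuous_const_smul g).measurable hA

omit [Countable G] [MeasurableSpace G] [DiscreteMeasurableSpace G] in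
theorem integral_translate (g : G) (ν : Measure M) {f : M → ℝ} (hf : Measurable f) :
    ∫ p, f p ∂(translate g ν) = ∫ p, f (g • p) ∂ν :=
  integral_map (continuous_const_smul g).measurable.aemeasurable hf.aestronglyMeasurable

/-- A measure is stationary if and only if its convolution with `μ` is itself. -/
theorem isStationary_iff_map_prod (μ : Measure G) [IsProbabilityMeasure μ] (ν : Measure M)
    [IsProbabilityMeasure ν] :
    IsStationary μ ν ↔ (μ.prod ν).map (fun p : G × M => p.1 • p.2) = ν := by
  have key : ∀ A : Set M, MeasurableSet A → (μ.prod ν).map (fun p : G × M => p.1 • p.2) A =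
      ∑' g : G, μ {g} * translate g ν A := fun A hA => by
    rw [Measure.map_apply measurable_smul_prod hA, Measure.prod_apply (measurable_smul_prod hA),
      lintegral_countable']
    refine tsum_congr fun g => ?_
    rw [translate_apply g ν hA, mul_comm]
    rfl
  refine ⟨fun h => Measure.ext fun A hA => ?_, fun h A hA => ?_⟩
  · rw [key A hA, ← h A hA]
  · rw [← key A hA, h]

/-- The integral `∫ f d(gν)` as a function of `g`, written as an integral with respect to `ν`. -/
noncomputable def poissonIntegral (ν : Measure M) (f : C(M, ℝ)) (g : G) : ℝ :=
  ∫ p, f (g • p) ∂ν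

omit [Countable G] [MeasurableSpace G] [DiscreteMeasurableSpace G] in
theorem poissonIntegral_eq_integral_translate (ν : Measure M) (f : C(M, ℝ)) (g : G) :
    poissonIntegral ν f g = ∫ p, f p ∂(translate g ν) :=
  (integral_translate g ν f.continuous.measurable).symm

variable [CompactSpace M]

theorem integrable_comp_smul {X : Type*} [MeasurableSpace X] (m : Measure X) [IsFiniteMeasure m]
    (f : C(M, ℝ)) {F : X → M} (hF : Measurable F) : Integrable (fun p => f (F p)) m :=
  Integrable.of_bound (f.continuous.measurable.comp hF).aestronglyMeasurable ‖f‖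
    (ae_of_all _ fun _ => f.norm_coe_le_norm _)

omit [Countable G] [MeasurableSpace G] [DiscreteMeasurableSpace G]
  [BorelSpace M] [ContinuousConstSMul G M] in
theorem abs_poissonIntegral_le (ν : Measure M) [IsProbabilityMeasure ν] (f : C(M, ℝ)) (g : G) :
    |poissonIntegral ν f g| ≤ ‖f‖ := by
  have := norm_integral_le_of_norm_le_const (μ := ν) (f := fun p => f (g • p)) (C := ‖f‖)
    (ae_of_all _ fun _ => f.norm_coe_le_norm _)
  simpa [poissonIntegral] using this

theorem integral_map_smul_prod (μ : Measure G) [IsProbabilityMeasure μ] (ν : Measure M)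
    [IsProbabilityMeasure ν] (f : C(M, ℝ)) :
    ∫ p, f p ∂((μ.prod ν).map (fun p : G × M => p.1 • p.2)) =
      ∫ g, poissonIntegral ν f g ∂μ := by
  rw [integral_map measurable_smul_prod.aemeasurable
    f.continuous.measurable.aestronglyMeasurable]
  exact integral_prod (fun p : G × M => f (p.1 • p.2))
    (integrable_comp_smul _ f measurable_smul_prod)

/-- For a stationary measure the function `g ↦ ∫ f d(gν)` has the mean value property. -/
theorem IsStationary.integral_poissonIntegral_mul {μ : Measure G} [IsProbabilityMeasure μ]
    {ν : Measure M} [IsProbabilityMeasure ν] (hν : IsStationary μ ν) (f : C(M, ℝ)) (g : G) :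
    ∫ k, poissonIntegral ν f (g * k) ∂μ = poissonIntegral ν f g := by
  let f' : C(M, ℝ) := f.comp ⟨fun p => g • p, continuous_const_smul g⟩
  have h := integral_map_smul_prod μ ν f'
  rw [(isStationary_iff_map_prod μ ν).1 hν] at h
  rw [show poissonIntegral ν f g = ∫ p, f' p ∂ν from rfl, h]
  simp only [poissonIntegral, mul_smul]
  rfl

omit [CompactSpace M] in
theorem ext_of_forall_integral_eq [TopologicalSpace.MetrizableSpace M] {ν ν' : Measure M}
    [IsFiniteMeasure ν] [IsFiniteMeasure ν']
    (h : ∀ f : C(M, ℝ), ∫ p, f p ∂ν = ∫ p, f p ∂ν') : ν = ν' :=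
  ext_of_forall_integral_eq_of_IsFiniteMeasure fun f => h f.toContinuousMap

/-- Existence of a stationary measure: a limit point of the averages of the iterated convolutions
`μ * ⋯ * μ * δ` is stationary. -/
theorem exists_isStationary [TopologicalSpace.MetrizableSpace M] [Nonempty M]
    (μ : Measure G) [IsProbabilityMeasure μ] :
    ∃ ν : Measure M, IsProbabilityMeasure ν ∧ IsStationary μ ν := by
  let Φ : ProbabilityMeasure M → ProbabilityMeasure M := fun ν =>
    ⟨(μ.prod (ν : Measure M)).map (fun p : G × M => p.1 • p.2),
      Measure.isProbabilityMeasure_map measurable_smul_prod.aemeasurable⟩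
  have hmeas : ∀ f : C(M, ℝ), ∀ y : M, AEStronglyMeasurable (fun g : G => f (g • y)) μ :=
    fun f y => (Measurable.of_discrete).aestronglyMeasurable
  -- the adjoint operator on continuous functions
  let T : C(M, ℝ) → C(M, ℝ) := fun f => ⟨fun y => ∫ g, f (g • y) ∂μ,
    continuous_of_dominated (bound := fun _ => ‖f‖) (hmeas f)
      (fun y => ae_of_all _ fun g => f.norm_coe_le_norm _) (integrable_const _)
      (ae_of_all _ fun g => f.continuous.comp (continuous_const_smul g))⟩
  have hT : ∀ (ν : ProbabilityMeasure M) (f : C(M, ℝ)),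
      ∫ p, f p ∂(Φ ν : Measure M) = ∫ p, T f p ∂(ν : Measure M) := fun ν f => by
    refine (integral_map_smul_prod μ (ν : Measure M) f).trans ?_
    exact integral_integral_swap (f := fun (g : G) (p : M) => f (g • p))
      (integrable_comp_smul _ f measurable_smul_prod)
  let m : ℕ → ProbabilityMeasure M := fun k => Φ^[k] ⟨Measure.dirac (Classical.arbitrary M),
    inferInstance⟩
  have hm : ∀ k (f : C(M, ℝ)), ∫ p, T f p ∂(m k : Measure M) = ∫ p, f p ∂(m (k + 1) : Measure M) :=
    fun k f => by
      rw [← hT]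
      have : m (k + 1) = Φ (m k) := Function.iterate_succ_apply' Φ k _
      rw [this]
  let A : ℕ → Measure M := fun n =>
    ((n + 1 : ℕ) : ENNReal)⁻¹ • ∑ k ∈ Finset.range (n + 1), (m k : Measure M)
  have hA : ∀ n, IsProbabilityMeasure (A n) := fun n => ⟨by
    simp only [A, Measure.smul_apply, Measure.finsetSum_apply, measure_univ, smul_eq_mul,
      Finset.sum_const, Finset.card_range, nsmul_eq_mul, mul_one]
    exact ENNReal.inv_mul_cancel (by simp) (by simp)⟩
  have hAint : ∀ n (f : C(M, ℝ)), ∫ p, f p ∂(A n) =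
      ((n : ℝ) + 1)⁻¹ * ∑ k ∈ Finset.range (n + 1), ∫ p, f p ∂(m k : Measure M) := fun n f => by
    simp only [A]
    rw [integral_smul_measure, integral_finsetSum_measure
      (μ := fun k => (m k : Measure M)) (f := f)
      (fun k _ => integrable_comp_smul _ f measurable_id)]
    rw [ENNReal.toReal_inv, smul_eq_mul, ENNReal.toReal_natCast]
    push_cast
    rfl
  let U : Ultrafilter ℕ := Ultrafilter.of atTop
  have hU : (U : Filter ℕ) ≤ atTop := Ultrafilter.of_le atTop
  let B : ℕ → ProbabilityMeasure M := fun n => ⟨A n, hA n⟩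
  obtain ⟨ν, -, hν⟩ : ∃ ν ∈ Set.univ, Tendsto B U (𝓝 ν) :=
    isCompact_univ.ultrafilter_le_nhds (U.map B) (by simp)
  have hlim : ∀ f : C(M, ℝ), Tendsto (fun n => ∫ p, f p ∂(A n)) U (𝓝 (∫ p, f p ∂(ν : Measure M))) :=
    fun f => ProbabilityMeasure.tendsto_iff_forall_integral_tendsto.1 hν
      (BoundedContinuousFunction.mkOfCompact f)
  refine ⟨ν, inferInstance, (isStationary_iff_map_prod μ _).2 ?_⟩
  have : IsProbabilityMeasure ((μ.prod (ν : Measure M)).map (fun p : G × M => p.1 • p.2)) :=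
    Measure.isProbabilityMeasure_map measurable_smul_prod.aemeasurable
  refine ext_of_forall_integral_eq fun f => (hT ν f).trans ?_
  refine tendsto_nhds_unique (hlim (T f)) ?_
  -- the integrals of `T f` against the averages telescope
  have hdiff : Tendsto (fun n : ℕ => ((n : ℝ) + 1)⁻¹ * (∫ p, f p ∂(m (n + 1) : Measure M) -
      ∫ p, f p ∂(m 0 : Measure M))) atTop (𝓝 0) := by
    have h0 : Tendsto (fun n : ℕ => ((n : ℝ) + 1)⁻¹) atTop (𝓝 0) := by
      simpa using tendsto_one_div_add_atTop_nhds_zero_nat (𝕜 := ℝ)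
    refine h0.zero_mul_isBoundedUnder_le
      ⟨2 * ‖f‖, eventually_map.2 (Eventually.of_forall fun n => ?_)⟩
    have hb : ∀ k, ‖∫ p, f p ∂(m k : Measure M)‖ ≤ ‖f‖ := fun k => by
      simpa using norm_integral_le_of_norm_le_const (μ := (m k : Measure M)) (C := ‖f‖)
        (ae_of_all _ fun p => f.norm_coe_le_norm p)
    have := norm_sub_le (∫ p, f p ∂(m (n + 1) : Measure M)) (∫ p, f p ∂(m 0 : Measure M))
    have h1 := hb (n + 1)
    have h2 := hb 0
    simp only [Function.comp]
    linarith
  have := (hlim f).add (hdiff.mono_left hU)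
  rw [add_zero] at this
  refine this.congr fun n => ?_
  rw [hAint, hAint, ← mul_add]
  congr 1
  simp only [hm]
  rw [← Finset.sum_range_sub (fun k => ∫ p, f p ∂(m k : Measure M)), ← Finset.sum_add_distrib]
  exact Finset.sum_congr rfl fun k _ => by ring

open scoped Pointwise in
/-- A stationary measure has no atoms: the atoms of maximal mass would form a finite invariant
set. -/
theorem IsStationary.measure_singleton [Infinite G] [TopologicalSpace.MetrizableSpace M]
    (hconv : IsConvergenceAction G M) (hne : IsNonelementary G M) {μ : Measure G}
    [IsProbabilityMeasure μ] (hμ : Subgroup.closure {g : G | μ {g} ≠ 0} = ⊤)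
    {ν : Measure M} [IsProbabilityMeasure ν] (hν : IsStationary μ ν) (p : M) : ν {p} = 0 := by
  by_contra hp
  have hfin : ∀ {ε : ENNReal}, ε ≠ 0 → {q : M | ε ≤ ν {q}}.Finite := fun {ε} hε =>
    Measure.finite_const_le_meas_of_disjoint_iUnion ν (pos_iff_ne_zero.2 hε)
      (fun q => measurableSet_singleton q)
      (fun q r hqr => Set.disjoint_singleton.2 hqr) (measure_ne_top _ _)
  obtain ⟨q, hq, hmax⟩ := (hfin hp).exists_maximalFor (fun q => ν {q}) _ ⟨p, le_refl (ν {p})⟩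
  have hmax' : ∀ r, ν {r} ≤ ν {q} := fun r => by
    rcases le_total (ν {r}) (ν {q}) with h | h
    · exact h
    · exact hmax (hq.trans h) h
  have hq0 : ν {q} ≠ 0 := ((pos_iff_ne_zero.2 hp).trans_le hq).ne'
  set F : Set M := {r | ν {q} ≤ ν {r}}
  have hFfin : F.Finite := hfin hq0
  have hsupp : ∀ g : G, μ {g} ≠ 0 → g⁻¹ ∈ MulAction.stabilizer G F := fun g hg => by
    have hsub : g⁻¹ • F ⊆ F := by
      rintro _ ⟨r, hr, rfl⟩
      have hr' : ν {r} = ν {q} := le_antisymm (hmax' r) hr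
      have hpre : ∀ k : G, translate k ν {r} = ν {k⁻¹ • r} := fun k => by
        rw [translate_apply k ν (measurableSet_singleton r)]
        congr 1
        ext y
        simp [eq_inv_smul_iff]
      have hint : ∫⁻ k, ν {k⁻¹ • r} ∂μ = ν {q} := by
        rw [lintegral_countable', ← hr', hν {r} (measurableSet_singleton r)]
        exact tsum_congr fun k => by rw [hpre, mul_comm]
      have hae : (fun k : G => ν {k⁻¹ • r}) =ᵐ[μ] fun _ => ν {q} :=
        ae_eq_of_ae_le_of_lintegral_le (ae_of_all _ fun k => hmax' _)
          (by rw [hint]; exact measure_ne_top _ _) aemeasurable_const (by rw [hint]; simp)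
      exact ((ae_iff_of_countable.1 hae) g hg).ge
    exact Set.eq_of_subset_of_ncard_le hsub (by rw [Set.ncard_smul_set]) hFfin
  have htop : MulAction.stabilizer G F = ⊤ := by
    rw [eq_top_iff, ← hμ, Subgroup.closure_le]
    intro g hg
    simpa using hsupp g hg
  refine hconv.not_invariant_finite hne hFfin ⟨q, le_refl (ν {q})⟩ fun g y hy => ?_
  have hg : g • F = F := MulAction.mem_stabilizer_iff.1 (htop ▸ Subgroup.mem_top g)
  exact hg ▸ Set.smul_mem_smul_set hy

omit [Countable G] [MeasurableSpace G] [DiscreteMeasurableSpace G] in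
theorem tendsto_poissonIntegral_of_forall_ne {u : ℕ → G} {a b : M}
    (h : ∀ y, y ≠ a → Tendsto (fun n => u n • y) atTop (𝓝 b)) {ν : Measure M}
    [IsProbabilityMeasure ν] (hν : ∀ p, ν {p} = 0) (f : C(M, ℝ)) :
    Tendsto (fun n => poissonIntegral ν f (u n)) atTop (𝓝 (f b)) := by
  have := tendsto_integral_of_dominated_convergence (μ := ν) (F := fun n p => f (u n • p))
    (f := fun _ => f b) (fun _ => ‖f‖)
    (fun n => (f.continuous.comp (continuous_const_smul (u n))).measurable.aestronglyMeasurable)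
    (integrable_const _) (fun n => ae_of_all _ fun p => f.norm_coe_le_norm _)
    (by
      filter_upwards [compl_mem_ae_iff.2 (hν a)] with y hy
      exact (f.continuous.tendsto b).comp (h y hy))
  simpa using! this

omit [Countable G] [DiscreteMeasurableSpace G] in
/-- Not every element of the support of `μ` fixes `ν`: an invariant measure without atoms would
be a point mass by the convergence property. -/
theorem exists_poissonIntegral_ne [Infinite G] [TopologicalSpace.MetrizableSpace M]
    (hconv : IsConvergenceAction G M) {μ : Measure G}
    (hμ : Subgroup.closure {g : G | μ {g} ≠ 0} = ⊤)
    {ν : Measure M} [IsProbabilityMeasure ν] (hν : ∀ p, ν {p} = 0) (g : G) :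
    ∃ (f : C(M, ℝ)) (k : G), μ {k} ≠ 0 ∧ poissonIntegral ν f (g * k) ≠ poissonIntegral ν f g := by
  by_contra! hcon
  have hmap : ∀ k : G, k ∈ {k : G | μ {k} ≠ 0} → ν.map (fun p => k • p) = ν := fun k hk => by
    have : IsProbabilityMeasure (ν.map fun p => k • p) :=
      Measure.isProbabilityMeasure_map (continuous_const_smul k).measurable.aemeasurable
    refine ext_of_forall_integral_eq fun f => ?_
    -- the translate of `f` by `g⁻¹` undoes the base point `g`
    have h := hcon (f.comp ⟨fun p => g⁻¹ • p, continuous_const_smul g⁻¹⟩) k hk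
    simp only [poissonIntegral, ContinuousMap.comp_apply, ContinuousMap.coe_mk, mul_smul,
      inv_smul_smul] at h
    rw [← h]
    exact integral_translate k ν f.continuous.measurable
  have hall : ∀ k : G, ν.map (fun p => k • p) = ν := fun k => by
    have hk : k ∈ Subgroup.closure {g : G | μ {g} ≠ 0} := hμ ▸ Subgroup.mem_top k
    induction hk using Subgroup.closure_induction with
    | mem k hk => exact hmap k hk
    | one => simp
    | mul x y _ _ hx hy =>
      have h := Measure.map_map (μ := ν) (continuous_const_smul x).measurable
        (continuous_const_smul y).measurable
      rw [hy, hx] at h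
      simp only [mul_smul]
      exact h.symm
    | inv x _ hx =>
      have h := Measure.map_map (μ := ν) (continuous_const_smul x⁻¹).measurable
        (continuous_const_smul x).measurable
      rw [hx] at h
      rw [h]
      simp [Function.comp_def]
  obtain ⟨u, hu⟩ := exists_tendsto_cofinite_of_infinite G
  obtain ⟨φ, a, b, -, h⟩ := hconv.exists_subseq hu
  have hconst : ν = Measure.dirac b := ext_of_forall_integral_eq fun f => by
    rw [integral_dirac]
    refine tendsto_nhds_unique ?_ (tendsto_poissonIntegral_of_forall_ne h hν f)
    refine tendsto_const_nhds.congr fun n => ?_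
    rw [poissonIntegral_eq_integral_translate, translate, hall]
  have := hν b
  rw [hconst] at this
  simp at this

/-! ### The Poisson extension solves the Dirichlet problem -/

/-- For bounded functions harmonicity is a mean value property for the Bochner integral. -/
theorem isHarmonic_iff_integral {μ : Measure G} [IsProbabilityMeasure μ] {φ : G → ℝ} {C : ℝ}
    (hC : ∀ g, |φ g| ≤ C) : IsHarmonic μ φ ↔ ∀ g, ∫ k, φ (g * k) ∂μ = φ g := by
  have key : ∀ g, HasSum (fun k : G => μ.real {k} * φ (g * k)) (∫ k, φ (g * k) ∂μ) := fun g => by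
    have hint : Integrable (fun k => φ (g * k)) μ :=
      Integrable.of_bound Measurable.of_discrete.aestronglyMeasurable C
        (ae_of_all _ fun k => hC _)
    have hsum : Measure.sum (fun k : G => μ {k} • Measure.dirac k) = μ := Measure.sum_smul_dirac μ
    have h := hasSum_integral_measure (μ := fun k : G => μ {k} • Measure.dirac k)
      (f := fun k => φ (g * k)) (by rwa [hsum])
    rw [hsum] at h
    simpa [integral_smul_measure, Measure.real] using h
  exact forall_congr' fun g => ⟨fun h => (key g).unique h, fun h => h ▸ key g⟩

omit [Countable G] [MeasurableSpace G] [DiscreteMeasurableSpace G] in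
theorem tendsto_poissonIntegral [TopologicalSpace.MetrizableSpace M]
    (hconv : IsConvergenceAction G M) (x : DistinctTriple M) {ν : Measure M}
    [IsProbabilityMeasure ν] (hν : ∀ p, ν {p} = 0) (f : C(M, ℝ)) (b : M) :
    Tendsto (poissonIntegral ν f) (GroupUnion.boundaryFilter G x b) (𝓝 (f b)) := by
  refine tendsto_of_subseq_tendsto fun u hu => ?_
  obtain ⟨φ, a, b', hφ, h⟩ :=
    hconv.exists_subseq (hu.mono_right (GroupUnion.boundaryFilter_le_cofinite x b))
  obtain ⟨c, hc⟩ := GroupUnion.exists_tendsto_of_boundaryFilter (G := G) x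
  have hb : b = b' := tendsto_nhds_unique ((hc b).comp (hu.comp hφ))
    ((hc b').comp (GroupUnion.tendsto_boundaryFilter_of_forall_ne h x))
  exact ⟨φ, hb ▸ tendsto_poissonIntegral_of_forall_ne h hν f⟩

omit [Countable G] [MeasurableSpace G] [DiscreteMeasurableSpace G] [MeasurableSpace M]
  [BorelSpace M] [ContinuousConstSMul G M] [CompactSpace M] in
theorem GroupUnion.continuous_of_tendsto {x : DistinctTriple M} {h : GroupUnion G x → ℝ}
    {f : C(M, ℝ)} (hf : ∀ p, h (ofBoundary p) = f p)
    (hlim : ∀ b, Tendsto (fun g => h (ofGroup g)) (boundaryFilter G x b) (𝓝 (f b))) :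
    Continuous h := by
  refine continuous_iff_continuousAt.2 fun z => ?_
  rcases z with g | b
  · rw [ContinuousAt, (isOpen_singleton_iff_nhds_eq_pure _).1 (isOpen_singleton_ofGroup x g)]
    exact tendsto_pure_nhds _ _
  · rw [ContinuousAt, hf]
    intro V hV
    obtain ⟨U, hU, hUV⟩ := (boundaryFilter_hasBasis x b).mem_iff.1 (hlim b hV)
    obtain ⟨W, hW, hWV⟩ := (nhds_basis_opens b).mem_iff.1 (f.continuous.tendsto b hV)
    refine (nhds_ofBoundary_hasBasis x b).mem_iff.2
      ⟨U ∩ W, ⟨hU.1.inter hW.2, hU.2, hW.1⟩, ?_⟩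
    rintro (g | p) hz
    · obtain ⟨i, j, hij, hi, hj⟩ := hz
      exact hUV ⟨i, j, hij, hi.1, hj.1⟩
    · rw [Set.mem_preimage, hf]
      exact hWV hz.2

/-- The Poisson extension with respect to a stationary measure solves the Dirichlet problem. -/
theorem IsStationary.isDirichletSolution_poissonExtension [Infinite G]
    [TopologicalSpace.MetrizableSpace M]
    (hconv : IsConvergenceAction G M) (hne : IsNonelementary G M) {μ : Measure G}
    [IsProbabilityMeasure μ] (hμ : Subgroup.closure {g : G | μ {g} ≠ 0} = ⊤)
    {ν : Measure M} [IsProbabilityMeasure ν] (hν : IsStationary μ ν) (x : DistinctTriple M)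
    (f : C(M, ℝ)) : IsDirichletSolution μ x f (poissonExtension ν x f) := by
  have hG : (fun g : G => poissonExtension ν x f (.ofGroup g)) = poissonIntegral ν f :=
    funext fun g => (poissonIntegral_eq_integral_translate ν f g).symm
  refine ⟨GroupUnion.continuous_of_tendsto (fun _ => rfl) fun b => ?_, ?_, fun _ => rfl⟩
  · rw [hG]
    exact tendsto_poissonIntegral hconv x (hν.measure_singleton hconv hne hμ) f b
  · rw [hG]
    exact (isHarmonic_iff_integral (abs_poissonIntegral_le ν f)).2
      (hν.integral_poissonIntegral_mul f)

omit [Countable G] [DiscreteMeasurableSpace G] [MeasurableSpace M] [BorelSpace M]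
  [ContinuousConstSMul G M] [CompactSpace M] in
/-- Solutions of the Dirichlet problem are bounded on `G`, since every sequence in `G` that leaves
the finite sets has a limit point in `M`. -/
theorem IsDirichletSolution.exists_bound [TopologicalSpace.MetrizableSpace M]
    (hconv : IsConvergenceAction G M) {μ : Measure G} {x : DistinctTriple M} {f : C(M, ℝ)}
    {h : GroupUnion G x → ℝ} (hh : IsDirichletSolution μ x f h) :
    ∃ C, ∀ g : G, |h (.ofGroup g)| ≤ C := by
  by_contra! hcon
  choose u hu using fun n : ℕ => hcon n
  have hu' : Tendsto u atTop cofinite := by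
    refine le_cofinite_iff_eventually_ne.2 fun g => ?_
    obtain ⟨N, hN⟩ := exists_nat_gt |h (.ofGroup g)|
    refine eventually_map.2 ?_
    filter_upwards [eventually_ge_atTop N] with n hn hng
    have h1 := hu n
    rw [hng] at h1
    have : (N : ℝ) ≤ n := by exact_mod_cast hn
    linarith
  obtain ⟨φ, a, b, hφ, hab⟩ := hconv.exists_subseq hu'
  have hlim := GroupUnion.tendsto_boundaryFilter.1
    (GroupUnion.tendsto_boundaryFilter_of_forall_ne hab x)
  have h1 := ((hh.continuous.tendsto _).comp hlim).abs
  refine not_tendsto_atTop_of_tendsto_nhds h1 (tendsto_atTop_mono (fun n => (hu (φ n)).le) ?_)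
  exact tendsto_natCast_atTop_atTop.comp hφ

end Stationary

/-! ### Bounded harmonic functions along the random walk -/

section Walk

variable {G : Type*} [Group G] [Countable G] [MeasurableSpace G] [DiscreteMeasurableSpace G]

/-- The filtration of the random walk: at time `n` the first `n` steps are known. -/
def stepFiltration (G : Type*) [MeasurableSpace G] :
    Filtration ℕ (MeasurableSpace.pi : MeasurableSpace (ℕ → G)) where
  seq n := Filtration.piFinset (X := fun _ : ℕ => G) (Finset.range n)
  mono' _ _ h := Filtration.piFinset.mono (Finset.range_mono h)
  le' _ := Filtration.piFinset.le _

theorem measurable_walk (g₀ : G) (n : ℕ) :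
    Measurable[stepFiltration G n] fun ω : ℕ → G => walk g₀ ω n := by
  induction n with
  | zero => exact measurable_const
  | succ n ih =>
    have h1 : Measurable[stepFiltration G (n + 1)] fun ω : ℕ → G => walk g₀ ω n :=
      ih.mono ((stepFiltration G).mono n.le_succ) le_rfl
    have h3 : Measurable[stepFiltration G (n + 1)]
        fun (ω : ℕ → G) (i : Finset.range (n + 1)) => ω i :=
      measurable_iff_comap_le.2 (le_refl (Filtration.piFinset (Finset.range (n + 1))))
    have h2 : Measurable[stepFiltration G (n + 1)] fun ω : ℕ → G => ω n :=
      (@measurable_pi_iff _ _ _ (stepFiltration G (n + 1)) _ _).1 h3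
        ⟨n, Finset.self_mem_range_succ n⟩
    exact (Measurable.of_discrete (f := fun p : G × G => p.1 * p.2)).comp (h1.prodMk h2)

theorem measurable_walk' (g₀ : G) (n : ℕ) : Measurable fun ω : ℕ → G => walk g₀ ω n :=
  (measurable_walk g₀ n).mono ((stepFiltration G).le n) le_rfl

variable (μ : Measure G) [IsProbabilityMeasure μ]

omit [Group G] [Countable G] [DiscreteMeasurableSpace G] in
theorem indep_stepFiltration (n : ℕ) :
    ProbabilityTheory.Indep (stepFiltration G n)
      (MeasurableSpace.comap (fun ω : ℕ → G => ω n) inferInstance)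
      (Measure.infinitePi fun _ : ℕ => μ) := by
  have h := (ProbabilityTheory.iIndepFun_infinitePi (P := fun _ : ℕ => μ)
    (X := fun _ ω => ω) (fun _ => measurable_id)).indepFun_finset (Finset.range n) {n}
    (by simp) (fun i => measurable_pi_apply i)
  have h' := h.comp (φ := id) (ψ := fun v => v ⟨n, Finset.mem_singleton_self n⟩) measurable_id
    (measurable_pi_apply (X := fun _ : ({n} : Finset ℕ) => G) ⟨n, Finset.mem_singleton_self n⟩)
  exact h'

variable {μ}

/-- The Markov property, integrated over an event of the past. -/
theorem setIntegral_walk_succ (g₀ : G) {ψ : G → ℝ} {C : ℝ} (hψ : ∀ g, |ψ g| ≤ C) (n : ℕ)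
    {A : Set (ℕ → G)} (hA : MeasurableSet[stepFiltration G n] A) :
    ∫ ω in A, ψ (walk g₀ ω (n + 1)) ∂(Measure.infinitePi fun _ : ℕ => μ) =
      ∫ ω in A, ∫ k, ψ (walk g₀ ω n * k) ∂μ ∂(Measure.infinitePi fun _ : ℕ => μ) := by
  set P := Measure.infinitePi fun _ : ℕ => μ
  have hA' : MeasurableSet A := (stepFiltration G).le n A hA
  -- the part of the past that matters: the position at time `n` and whether `A` has occurred
  let Y : (ℕ → G) → G × ℝ := fun ω => (walk g₀ ω n, A.indicator (fun _ => 1) ω)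
  have hY : Measurable[stepFiltration G n] Y :=
    (measurable_walk g₀ n).prodMk
      (Measurable.indicator (@measurable_const _ _ _ (stepFiltration G n) _) hA)
  have hY' : Measurable Y := hY.mono ((stepFiltration G).le n) le_rfl
  have hind : ProbabilityTheory.IndepFun Y (fun ω : ℕ → G => ω n) P :=
    ProbabilityTheory.indep_of_indep_of_le_left (indep_stepFiltration μ n) hY.comap_le
  have hprod := (ProbabilityTheory.indepFun_iff_map_prod_eq_prod_map_map hY'.aemeasurable
    (measurable_pi_apply n).aemeasurable).1 hind
  rw [Measure.infinitePi_map_eval] at hprod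
  have : IsProbabilityMeasure (P.map Y) := Measure.isProbabilityMeasure_map hY'.aemeasurable
  have hF : Measurable fun p : (G × ℝ) × G => p.1.2 * ψ (p.1.1 * p.2) :=
    measurable_fst.snd.mul ((Measurable.of_discrete (f := fun p : G × G => ψ (p.1 * p.2))).comp
      (measurable_fst.fst.prodMk measurable_snd))
  have hint : Integrable (fun p : (G × ℝ) × G => p.1.2 * ψ (p.1.1 * p.2))
      ((P.map Y).prod μ) := by
    rw [← hprod, integrable_map_measure hF.aestronglyMeasurable
      (hY'.prodMk (measurable_pi_apply n)).aemeasurable]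
    refine Integrable.of_bound (hF.comp (hY'.prodMk (measurable_pi_apply n))).aestronglyMeasurable
      C (ae_of_all _ fun ω => ?_)
    have hC : 0 ≤ C := (abs_nonneg _).trans (hψ 1)
    by_cases hω : ω ∈ A <;> simp [Y, hω, hψ, hC]
  calc ∫ ω in A, ψ (walk g₀ ω (n + 1)) ∂P
      = ∫ ω, (Y ω).2 * ψ ((Y ω).1 * ω n) ∂P := by
        rw [← integral_indicator hA']
        refine integral_congr_ae (ae_of_all _ fun ω => ?_)
        by_cases hω : ω ∈ A <;> simp [Y, hω, walk]
    _ = ∫ p, p.1.2 * ψ (p.1.1 * p.2) ∂((P.map Y).prod μ) := by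
        rw [← hprod, integral_map (hY'.prodMk (measurable_pi_apply n)).aemeasurable
          hF.aestronglyMeasurable]
    _ = ∫ y, ∫ k, y.2 * ψ (y.1 * k) ∂μ ∂(P.map Y) := integral_prod _ hint
    _ = ∫ ω, (Y ω).2 * ∫ k, ψ ((Y ω).1 * k) ∂μ ∂P := by
        rw [integral_map hY'.aemeasurable hint.integral_prod_left.aestronglyMeasurable]
        simp only [integral_const_mul]
    _ = ∫ ω in A, ∫ k, ψ (walk g₀ ω n * k) ∂μ ∂P := by
        rw [← integral_indicator hA']
        refine integral_congr_ae (ae_of_all _ fun ω => ?_)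
        by_cases hω : ω ∈ A <;> simp [Y, hω]

theorem integrable_comp_walk (g₀ : G) {ψ : G → ℝ} {C : ℝ} (hψ : ∀ g, |ψ g| ≤ C) (n : ℕ) :
    Integrable (fun ω : ℕ → G => ψ (walk g₀ ω n)) (Measure.infinitePi fun _ : ℕ => μ) :=
  Integrable.of_bound
    ((Measurable.of_discrete (f := ψ)).comp (measurable_walk' g₀ n)).aestronglyMeasurable C
    (ae_of_all _ fun _ => hψ _)

theorem martingale_comp_walk (g₀ : G) {φ : G → ℝ} {C : ℝ} (hC : ∀ g, |φ g| ≤ C)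
    (hφ : ∀ g, ∫ k, φ (g * k) ∂μ = φ g) :
    Martingale (fun n (ω : ℕ → G) => φ (walk g₀ ω n)) (stepFiltration G)
      (Measure.infinitePi fun _ : ℕ => μ) := by
  refine martingale_of_setIntegral_eq_succ
    (fun n => ((Measurable.of_discrete (f := φ)).comp (measurable_walk g₀ n)).stronglyMeasurable)
    (integrable_comp_walk g₀ hC) fun n A hA => ?_
  rw [setIntegral_walk_succ g₀ hC n hA]
  simp only [hφ]

theorem ae_exists_tendsto_comp_walk (g₀ : G) {φ : G → ℝ} {C : ℝ} (hC : ∀ g, |φ g| ≤ C)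
    (hφ : ∀ g, ∫ k, φ (g * k) ∂μ = φ g) :
    ∀ᵐ ω ∂(Measure.infinitePi fun _ : ℕ => μ),
      ∃ c, Tendsto (fun n => φ (walk g₀ ω n)) atTop (𝓝 c) := by
  refine (martingale_comp_walk g₀ hC hφ).submartingale.exists_ae_tendsto_of_bdd (R := C.toNNReal)
    fun n => ?_
  refine (eLpNorm_le_of_ae_bound (C := C) (ae_of_all _ fun ω => hC _)).trans ?_
  simp [ENNReal.ofReal]

theorem integral_comp_walk (g₀ : G) {φ : G → ℝ} {C : ℝ} (hC : ∀ g, |φ g| ≤ C)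
    (hφ : ∀ g, ∫ k, φ (g * k) ∂μ = φ g) (n : ℕ) :
    ∫ ω, φ (walk g₀ ω n) ∂(Measure.infinitePi fun _ : ℕ => μ) = φ g₀ := by
  induction n with
  | zero => simp [walk]
  | succ n ih =>
    have h := setIntegral_walk_succ (μ := μ) g₀ hC n MeasurableSet.univ
    simpa only [Measure.restrict_univ, hφ, ih] using h

/-- If a bounded harmonic function `φ` is not constant along the steps from `g`, then almost every
path visits `g` only finitely often: each visit contributes the variance of `φ` along a step from
`g` to the second moment of the bounded martingale `φ (walk n)`. -/
theorem ae_eventually_walk_ne (g₀ : G) {φ : G → ℝ} {C : ℝ} (hC : ∀ g, |φ g| ≤ C)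
    (hφ : ∀ g, ∫ k, φ (g * k) ∂μ = φ g) {g k : G} (hk : μ {k} ≠ 0) (hgk : φ (g * k) ≠ φ g) :
    ∀ᵐ ω ∂(Measure.infinitePi fun _ : ℕ => μ), ∀ᶠ n in atTop, walk g₀ ω n ≠ g := by
  set P := Measure.infinitePi fun _ : ℕ => μ
  have hint : ∀ g, Integrable (fun k => φ (g * k)) μ := fun g =>
    Integrable.of_bound Measurable.of_discrete.aestronglyMeasurable C (ae_of_all _ fun k => hC _)
  have hC2 : ∀ g, |φ g ^ 2| ≤ C ^ 2 := fun g => by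
    rw [abs_pow]
    exact pow_le_pow_left₀ (abs_nonneg _) (hC g) 2
  have hint2 : ∀ g, Integrable (fun k => φ (g * k) ^ 2) μ := fun g =>
    Integrable.of_bound Measurable.of_discrete.aestronglyMeasurable (C ^ 2)
      (ae_of_all _ fun k => hC2 _)
  -- the variance of `φ` along a step from `g`
  let V : G → ℝ := fun g => ∫ k, (φ (g * k) - φ g) ^ 2 ∂μ
  have hV0 : ∀ g, 0 ≤ V g := fun g => integral_nonneg fun k => sq_nonneg _
  have hVeq : ∀ g, V g = ∫ k, φ (g * k) ^ 2 ∂μ - φ g ^ 2 := fun g => by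
    have : ∀ k, (φ (g * k) - φ g) ^ 2 = φ (g * k) ^ 2 - 2 * φ g * φ (g * k) + φ g ^ 2 :=
      fun k => by ring
    have h1 := integral_add ((hint2 g).sub ((hint g).const_mul (2 * φ g)))
      (integrable_const (φ g ^ 2))
    have h2 := integral_sub (hint2 g) ((hint g).const_mul (2 * φ g))
    simp only [Pi.sub_apply] at h1
    simp only [V, this]
    rw [h1, h2, integral_const_mul, hφ]
    simp
    ring
  have hVint : ∀ g, Integrable (fun k => (φ (g * k) - φ g) ^ 2) μ := fun g => by
    have : ∀ k, (φ (g * k) - φ g) ^ 2 = φ (g * k) ^ 2 - 2 * φ g * φ (g * k) + φ g ^ 2 :=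
      fun k => by ring
    simp only [this]
    exact ((hint2 g).sub ((hint g).const_mul _)).add (integrable_const _)
  have hVpos : 0 < V g := by
    refine lt_of_le_of_ne (hV0 g) fun h => ?_
    have h0 := (integral_eq_zero_iff_of_nonneg (fun k => sq_nonneg _) (hVint g)).1 h.symm
    have := ae_iff_of_countable.1 h0 k hk
    exact hgk (sub_eq_zero.1 (pow_eq_zero_iff two_ne_zero |>.1 this))
  -- the second moments of the martingale, whose increments are the means of `V (walk n)`
  let a : ℕ → ℝ := fun n => ∫ ω, φ (walk g₀ ω n) ^ 2 ∂P
  have ha : ∀ n, a n ∈ Set.Icc 0 (C ^ 2) := fun n => by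
    refine ⟨integral_nonneg fun _ => sq_nonneg _, ?_⟩
    have := norm_integral_le_of_norm_le_const (μ := P) (f := fun ω => φ (walk g₀ ω n) ^ 2)
      (ae_of_all _ fun ω => hC2 _)
    exact (le_abs_self _).trans (by simpa using this)
  have hstep : ∀ n, V g * P.real {ω | walk g₀ ω n = g} ≤ a (n + 1) - a n := fun n => by
    have hms : MeasurableSet {ω : ℕ → G | walk g₀ ω n = g} :=
      measurable_walk' g₀ n (measurableSet_singleton g)
    have h := setIntegral_walk_succ (μ := μ) g₀ hC2 n MeasurableSet.univ
    simp only [Measure.restrict_univ] at h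
    have hPint : Integrable (fun ω : ℕ → G => ∫ k, φ (walk g₀ ω n * k) ^ 2 ∂μ) P :=
      integrable_comp_walk g₀ (ψ := fun g => ∫ k, φ (g * k) ^ 2 ∂μ) (C := C ^ 2) (fun g => by
        simpa using norm_integral_le_of_norm_le_const (μ := μ) (f := fun k => φ (g * k) ^ 2)
          (ae_of_all _ fun k => hC2 _)) n
    have h1 : a (n + 1) - a n = ∫ ω, V (walk g₀ ω n) ∂P := by
      simp only [a, hVeq]
      rw [h, integral_sub hPint (integrable_comp_walk g₀ hC2 n)]
    have hVI : Integrable (fun ω : ℕ → G => V (walk g₀ ω n)) P := by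
      simp only [hVeq]
      exact hPint.sub (integrable_comp_walk g₀ hC2 n)
    rw [h1, mul_comm, ← smul_eq_mul, ← integral_indicator_const _ hms]
    refine integral_mono ((integrable_const _).indicator hms) hVI fun ω => ?_
    by_cases hω : walk g₀ ω n = g
    · simp [hω]
    · simpa [hω] using hV0 _
  have hsummable : Summable fun n => P.real {ω | walk g₀ ω n = g} := by
    refine summable_of_sum_range_le (c := C ^ 2 / V g) (fun n => measureReal_nonneg) fun n => ?_
    rw [le_div_iff₀' hVpos, Finset.mul_sum]
    refine (Finset.sum_le_sum fun i _ => hstep i).trans ?_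
    rw [Finset.sum_range_sub]
    linarith [(ha n).2, (ha 0).1]
  have hP : ∀ n, ENNReal.ofReal (P.real {ω | walk g₀ ω n = g}) = P {ω | walk g₀ ω n = g} :=
    fun n => ofReal_measureReal
  have hne := hsummable.tsum_ofReal_ne_top
  simp only [hP] at hne
  exact ae_eventually_notMem hne

end Walk

/-! ### Convergence to the boundary and the Poisson formula -/

section Boundary

variable {G M : Type*} [Group G] [Countable G] [Infinite G]
  [MeasurableSpace G] [DiscreteMeasurableSpace G]
  [TopologicalSpace M] [CompactSpace M] [TopologicalSpace.MetrizableSpace M]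
  [MeasurableSpace M] [BorelSpace M] [MulAction G M] [ContinuousConstSMul G M]
  {μ : Measure G} [IsProbabilityMeasure μ]

theorem IsStationary.ae_tendsto_walk_cofinite (hconv : IsConvergenceAction G M)
    (hne : IsNonelementary G M) (hμ : Subgroup.closure {g : G | μ {g} ≠ 0} = ⊤) {ν : Measure M}
    [IsProbabilityMeasure ν] (hν : IsStationary μ ν) (g₀ : G) :
    ∀ᵐ ω ∂(Measure.infinitePi fun _ : ℕ => μ), Tendsto (walk g₀ ω) atTop cofinite := by
  simp only [Tendsto, le_cofinite_iff_eventually_ne, eventually_map]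
  refine ae_all_iff.2 fun g => ?_
  obtain ⟨f, k, hk, hfk⟩ :=
    exists_poissonIntegral_ne hconv hμ (hν.measure_singleton hconv hne hμ) g
  exact ae_eventually_walk_ne g₀ (abs_poissonIntegral_le ν f)
    (hν.integral_poissonIntegral_mul f) hk hfk

/-- Almost every path converges to a boundary point. The distances to a dense sequence of points
form a countable family of continuous functions `f` separating the points of `M`; for these the
convergence of `∫ f d(gν)` along the path leaves only one possible limit point. -/
theorem IsStationary.ae_exists_tendsto_walk (hconv : IsConvergenceAction G M)
    (hne : IsNonelementary G M) (hμ : Subgroup.closure {g : G | μ {g} ≠ 0} = ⊤) {ν : Measure M}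
    [IsProbabilityMeasure ν] (hν : IsStationary μ ν) (x : DistinctTriple M) (g₀ : G) :
    ∀ᵐ ω ∂(Measure.infinitePi fun _ : ℕ => μ),
      ∃ b, Tendsto (walk g₀ ω) atTop (GroupUnion.boundaryFilter G x b) := by
  let := TopologicalSpace.metrizableSpaceMetric M
  have : Nonempty M := ⟨x.1 0⟩
  have hatom := hν.measure_singleton hconv hne hμ
  let d : ℕ → C(M, ℝ) := fun i => ⟨fun y => dist y (TopologicalSpace.denseSeq M i), by fun_prop⟩
  have hd : ∀ b b' : M, (∀ i, d i b = d i b') → b = b' := fun b b' h => by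
    have heq : (fun y => dist b y) = fun y => dist b' y :=
      (TopologicalSpace.denseRange_denseSeq M).equalizer (by fun_prop) (by fun_prop)
        (funext fun i => h i)
    have := congrFun heq b'
    simpa using this
  filter_upwards [hν.ae_tendsto_walk_cofinite hconv hne hμ g₀,
    ae_all_iff.2 fun i => ae_exists_tendsto_comp_walk g₀ (abs_poissonIntegral_le ν (d i))
      (hν.integral_poissonIntegral_mul (d i))] with ω hcof hlim
  obtain ⟨φ, a, b, hφ, hb⟩ := hconv.exists_subseq hcof
  refine ⟨b, tendsto_of_subseq_tendsto fun ns hns => ?_⟩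
  obtain ⟨φ', a', b', hφ', hb'⟩ := hconv.exists_subseq (hcof.comp hns)
  have hbb' : b' = b := hd b' b fun i => by
    obtain ⟨c, hc⟩ := hlim i
    exact (tendsto_nhds_unique (tendsto_poissonIntegral_of_forall_ne hb' hatom (d i))
      (hc.comp (hns.comp hφ'))).trans
      (tendsto_nhds_unique (tendsto_poissonIntegral_of_forall_ne hb hatom (d i))
        (hc.comp hφ)).symm
  exact ⟨φ', hbb' ▸ GroupUnion.tendsto_boundaryFilter_of_forall_ne hb' x⟩

theorem IsStationary.exists_measurable_limit (hconv : IsConvergenceAction G M)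
    (hne : IsNonelementary G M) (hμ : Subgroup.closure {g : G | μ {g} ≠ 0} = ⊤) {ν : Measure M}
    [IsProbabilityMeasure ν] (hν : IsStationary μ ν) (x : DistinctTriple M) (g₀ : G) :
    ∃ Z : (ℕ → G) → M, Measurable Z ∧ ∀ᵐ ω ∂(Measure.infinitePi fun _ : ℕ => μ),
      Tendsto (fun n => (GroupUnion.ofGroup (walk g₀ ω n) : GroupUnion G x)) atTop
        (𝓝 (GroupUnion.ofBoundary (Z ω))) := by
  obtain ⟨c, hc⟩ := GroupUnion.exists_tendsto_of_boundaryFilter (G := G) x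
  have hlim := hν.ae_exists_tendsto_walk hconv hne hμ x g₀
  obtain ⟨Z, hZ, hZlim⟩ := measurable_limit_of_tendsto_metrizable_ae
    (f := fun n (ω : ℕ → G) => c (walk g₀ ω n)) (L := atTop)
    (μ := Measure.infinitePi fun _ : ℕ => μ)
    (fun n => ((Measurable.of_discrete (f := c)).comp (measurable_walk' g₀ n)).aemeasurable)
    (hlim.mono fun ω ⟨b, hb⟩ => ⟨b, (hc b).comp hb⟩)
  refine ⟨Z, hZ, ?_⟩
  filter_upwards [hlim, hZlim] with ω ⟨b, hb⟩ hZω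
  rw [tendsto_nhds_unique hZω ((hc b).comp hb)]
  exact GroupUnion.tendsto_boundaryFilter.1 hb

omit [Infinite G] [CompactSpace M] [MeasurableSpace M] [BorelSpace M] [ContinuousConstSMul G M] in
/-- A solution of the Dirichlet problem is the mean of its boundary values at the limit point of
the random walk. -/
theorem IsDirichletSolution.eq_integral_limit (hconv : IsConvergenceAction G M)
    {x : DistinctTriple M} {f : C(M, ℝ)} {h : GroupUnion G x → ℝ}
    (hh : IsDirichletSolution μ x f h) (g₀ : G) {Z : (ℕ → G) → M}
    (hZlim : ∀ᵐ ω ∂(Measure.infinitePi fun _ : ℕ => μ),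
      Tendsto (fun n => (GroupUnion.ofGroup (walk g₀ ω n) : GroupUnion G x)) atTop
        (𝓝 (GroupUnion.ofBoundary (Z ω)))) :
    h (.ofGroup g₀) = ∫ ω, f (Z ω) ∂(Measure.infinitePi fun _ : ℕ => μ) := by
  obtain ⟨C, hC⟩ := hh.exists_bound hconv
  have hφ := (isHarmonic_iff_integral hC).1 hh.harmonic
  have hlim := tendsto_integral_of_dominated_convergence
    (μ := Measure.infinitePi fun _ : ℕ => μ)
    (F := fun n ω => h (.ofGroup (walk g₀ ω n))) (f := fun ω => f (Z ω)) (fun _ => C)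
    (fun n => (integrable_comp_walk g₀ (ψ := fun g => h (.ofGroup g)) hC n).aestronglyMeasurable)
    (integrable_const _) (fun n => ae_of_all _ fun ω => hC _)
    (hZlim.mono fun ω hω => by
      rw [← hh.boundary]
      exact (hh.continuous.tendsto _).comp hω)
  refine tendsto_nhds_unique (tendsto_const_nhds.congr fun n => ?_) hlim
  exact (integral_comp_walk g₀ (φ := fun g => h (.ofGroup g)) hC hφ n).symm

theorem IsStationary.isDirichletSolution_iff (hconv : IsConvergenceAction G M)
    (hne : IsNonelementary G M) (hμ : Subgroup.closure {g : G | μ {g} ≠ 0} = ⊤) {ν : Measure M}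
    [IsProbabilityMeasure ν] (hν : IsStationary μ ν) (x : DistinctTriple M) (f : C(M, ℝ))
    (h : GroupUnion G x → ℝ) :
    IsDirichletSolution μ x f h ↔ h = poissonExtension ν x f := by
  have hP := hν.isDirichletSolution_poissonExtension hconv hne hμ x f
  refine ⟨fun hh => funext fun z => ?_, fun hh => hh ▸ hP⟩
  rcases z with g | p
  · obtain ⟨Z, -, hZ⟩ := hν.exists_measurable_limit hconv hne hμ x g
    rw [hh.eq_integral_limit hconv g hZ, hP.eq_integral_limit hconv g hZ]
  · exact hh.boundary p

theorem IsStationary.isHittingMeasure (hconv : IsConvergenceAction G M)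
    (hne : IsNonelementary G M) (hμ : Subgroup.closure {g : G | μ {g} ≠ 0} = ⊤) {ν : Measure M}
    [IsProbabilityMeasure ν] (hν : IsStationary μ ν) (x : DistinctTriple M) (g : G) :
    IsHittingMeasure μ x g (translate g ν) := by
  obtain ⟨Z, hZ, hZlim⟩ := hν.exists_measurable_limit hconv hne hμ x g
  refine ⟨Z, hZ, hZlim, ?_⟩
  have : IsProbabilityMeasure (translate g ν) :=
    Measure.isProbabilityMeasure_map (continuous_const_smul g).measurable.aemeasurable
  have : IsProbabilityMeasure ((Measure.infinitePi fun _ : ℕ => μ).map Z) :=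
    Measure.isProbabilityMeasure_map hZ.aemeasurable
  refine ext_of_forall_integral_eq fun f => ?_
  rw [integral_map hZ.aemeasurable f.continuous.measurable.aestronglyMeasurable,
    ← (hν.isDirichletSolution_poissonExtension hconv hne hμ x f).eq_integral_limit hconv g hZlim]
  rfl

/-- The Poisson extensions of `f` with respect to two stationary measures solve the same Dirichlet
problem, and their values at the identity are the integrals of `f`. -/
theorem IsStationary.unique (hconv : IsConvergenceAction G M)
    (hne : IsNonelementary G M) (hμ : Subgroup.closure {g : G | μ {g} ≠ 0} = ⊤) {ν ν' : Measure M}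
    [IsProbabilityMeasure ν] [IsProbabilityMeasure ν'] (hν : IsStationary μ ν)
    (hν' : IsStationary μ ν') (x : DistinctTriple M) : ν' = ν := by
  refine ext_of_forall_integral_eq fun f => ?_
  have h := (hν.isDirichletSolution_iff hconv hne hμ x f _).1
    (hν'.isDirichletSolution_poissonExtension hconv hne hμ x f)
  have h1 := congrFun h (.ofGroup 1)
  simpa [poissonExtension, translate] using h1

omit [Countable G] [Infinite G] [MeasurableSpace G] [DiscreteMeasurableSpace G]
  [TopologicalSpace M] [CompactSpace M] [TopologicalSpace.MetrizableSpace M]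
  [MeasurableSpace M] [BorelSpace M] [ContinuousConstSMul G M] in
theorem IsNonelementary.nonempty_distinctTriple [Nonempty M] (hne : IsNonelementary G M) :
    Nonempty (DistinctTriple M) := by
  have hcard : 2 < (Set.univ : Set M).encard := by
    by_contra! hle
    exact hne ⟨Set.univ, Set.univ_nonempty, hle, fun _ _ _ => trivial⟩
  have hcard' : (3 : ℕ∞) ≤ (Set.univ : Set M).encard := Order.add_one_le_of_lt hcard
  obtain ⟨s, -, hs⟩ := Set.exists_subset_encard_eq hcard'
  obtain ⟨p, q, r, hpq, hpr, hqr, -⟩ := Set.encard_eq_three.1 hs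
  refine ⟨⟨![p, q, r], fun i j hij => ?_⟩⟩
  fin_cases i <;> fin_cases j <;> simp_all [eq_comm]

end Boundary

end ConvergenceGroup

theorem mainTheorem9 {G M : Type*} [Group G] [Countable G] [Infinite G]
    [MeasurableSpace G] [DiscreteMeasurableSpace G]
    [TopologicalSpace M] [CompactSpace M] [TopologicalSpace.MetrizableSpace M]
    [MeasurableSpace M] [BorelSpace M]
    [MulAction G M] [ContinuousConstSMul G M]
    (hconv : ConvergenceGroup.IsConvergenceAction G M)
    (hne : ConvergenceGroup.IsNonelementary G M)
    (hmin : MulAction.IsMinimal G M)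
    (μ : Measure G) [IsProbabilityMeasure μ]
    (hμ : Subgroup.closure {g : G | μ {g} ≠ 0} = ⊤) :
    (∀ x : ConvergenceGroup.DistinctTriple M,
      ConvergenceGroup.DirichletProblemSolvable (G := G) μ x) ∧
    ∃ ν : Measure M, IsProbabilityMeasure ν ∧
      ConvergenceGroup.IsStationary μ ν ∧
      (∀ ν' : Measure M, IsProbabilityMeasure ν' →
        ConvergenceGroup.IsStationary μ ν' → ν' = ν) ∧
      ∀ x : ConvergenceGroup.DistinctTriple M,
        (∀ g : G, ConvergenceGroup.IsHittingMeasure μ x g (ConvergenceGroup.translate g ν)) ∧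
        ∀ (f : C(M, ℝ)) (h : ConvergenceGroup.GroupUnion G x → ℝ),
          ConvergenceGroup.IsDirichletSolution μ x f h ↔
            h = ConvergenceGroup.poissonExtension ν x f := by
  obtain ⟨u, hu⟩ := ConvergenceGroup.exists_tendsto_cofinite_of_infinite G
  obtain ⟨-, a, -⟩ := hconv.exists_subseq hu
  have : Nonempty M := ⟨a⟩
  obtain ⟨x₀⟩ := hne.nonempty_distinctTriple
  obtain ⟨ν, hνP, hν⟩ := ConvergenceGroup.exists_isStationary (M := M) μ
  exact ⟨fun x f => ⟨_, hν.isDirichletSolution_poissonExtension hconv hne hμ x f⟩,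
    ν, hνP, hν, fun ν' _ hν' => hν.unique hconv hne hμ hν' x₀,
    fun x => ⟨hν.isHittingMeasure hconv hne hμ x, hν.isDirichletSolution_iff hconv hne hμ x⟩⟩
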